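/- Theorem 1.1. Let $n,m\ge 0$, let $D\subset\mathbb R^n$ be a nonempty connected open set, and let $f:D\to\mathbb R^m$ be smooth. Write $M=\operatorname{graph} f=\{(x,f(x)):x\in D\}\subset\mathbb R^{n+m}=\mathbb R^n\times\mathbb R^m$ and let $Q_0=\{0\}\times\mathbb R^m$ be the coordinate $m$-plane. For linear subspaces $P,Q$ of $\mathbb R^{n+m}$ and a nonzero $u\in P$, consider the angle between $u$ and its orthogonal projection to $Q$ ($\pi/2$ if that projection is $0$). The Jordan angles between $P$ and $Q$ are the critical values of this angle on $P\setminus\{0\}$, where criticality is understood for the smooth function $\cos^2$ of the angle; equivalently, they are the $\theta\in[0,\pi/2]$ such that $\cos^2\theta$ is an eigenvalue of $\mathcal P_P\circ\mathcal P_Q|_P$, where $\mathcal P_P,\mathcal P_Q$ are the orthogonal projections. The multiplicity of $\theta$ is the dimension of that eigenspace, and $\operatorname{Arg}(P,Q)$ is the set of the Jordan angles. We say that $M$ has constant Jordan angles (CJA) relative to $Q_0$ if the set $\operatorname{Arg}(N_pM,Q_0)$ and the multiplicity of each of its elements do not depend on $p\in M$. Then $\operatorname{Arg}(T_pM,Q_0^\perp)$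 does not depend on $p$ either; let $g^N=|\operatorname{Arg}(N_pM,Q_0)|$ and $g^T=|\operatorname{Arg}(T_pM,Q_0^\perp)|$ be the numbers of distinct normal and tangent Jordan angles. $M$ is minimal if its mean curvature vector (the trace of its second fundamental form) vanishes identically. If $M$ is minimal, has CJA relative to $Q_0$, and $g^N\le 2$ and $g^T\le 2$, then $f$ is affine linear, i.e. it is the restriction to $D$ of an affine map $\mathbb R^n\to\mathbb R^m$; in other words, $M=S\cap(D\times\mathbb R^m)$ for an affine $n$-plane $S\subset\mathbb R^{n+m}$. -/

import Mathlib

open scoped ContDiff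

noncomputable section

namespace JordanAngles

section Angles

variable {V : Type*} [NormedAddCommGroup V] [InnerProductSpace ℝ V] [FiniteDimensional ℝ V]

/-- The square of the cosine of the angle between `v ∈ P` and its orthogonal projection to `Q`
(the angle is `π / 2` when that projection vanishes). -/
def cosSqAngle (P Q : Submodule ℝ V) (v : P) : ℝ :=
  Real.cos (InnerProductGeometry.angle (v : V) (Q.starProjection (v : V))) ^ 2

/-- `u` is an angle direction of `P` relative to `Q` with Jordan angle `θ`: `u` is a nonzero vector
of `P` which makes the angle `θ` with its orthogonal projection to `Q`, and it is a critical point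
of that angle on `P`. Criticality is expressed through the squared cosine, which is a smooth
function also where the angle takes its extreme values `0` and `π / 2`. -/
def IsAngleDirection (P Q : Submodule ℝ V) (θ : ℝ) (u : P) : Prop :=
  u ≠ 0 ∧ InnerProductGeometry.angle (u : V) (Q.starProjection (u : V)) = θ ∧
    HasFDerivAt (cosSqAngle P Q) (0 : P →L[ℝ] ℝ) u

/-- `Arg(P, Q)`, the set of the Jordan angles between `P` and `Q`. -/
def jordanAngles (P Q : Submodule ℝ V) : Set ℝ := {θ | ∃ u : P, IsAngleDirection P Q θ u}

/-- The angle space of `P` relative to `Q` associated with `θ`: the `u ∈ P` with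
`(𝒫 ∘ 𝒫₀) u = cos² θ • u`, where `𝒫` and `𝒫₀` are the orthogonal projections to `P` and `Q`. For `θ ∈ [0, π / 2]` it
consists of `0` and the angle directions (`isAngleDirection_iff`). -/
def angleSpace (P Q : Submodule ℝ V) (θ : ℝ) : Submodule ℝ V where
  carrier := {u | u ∈ P ∧ P.starProjection (Q.starProjection u) = Real.cos θ ^ 2 • u}
  zero_mem' := by simp
  add_mem' := by
    rintro a b ⟨ha, ha'⟩ ⟨hb, hb'⟩
    exact ⟨P.add_mem ha hb, by simp [ha', hb']⟩
  smul_mem' := by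
    rintro c a ⟨ha, ha'⟩
    exact ⟨P.smul_mem c ha, by simp [ha', smul_comm c]⟩

/-- The multiplicity of `θ`, the dimension of its angle space. -/
def multiplicity (P Q : Submodule ℝ V) (θ : ℝ) : ℕ := Module.finrank ℝ (angleSpace P Q θ)

theorem inner_starProjection_self (Q : Submodule ℝ V) (v w : V) :
    inner ℝ (Q.starProjection v) (Q.starProjection w) = inner ℝ v (Q.starProjection w) := by
  rw [Submodule.inner_starProjection_left_eq_right,
    Submodule.starProjection_eq_self_iff.2 (Submodule.starProjection_apply_mem Q w)]

theorem cos_angle_starProjection (Q : Submodule ℝ V) (v : V) :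
    Real.cos (InnerProductGeometry.angle v (Q.starProjection v)) =
      ‖Q.starProjection v‖ / ‖v‖ := by
  rw [InnerProductGeometry.cos_angle, ← inner_starProjection_self, real_inner_self_eq_norm_sq]
  by_cases h : ‖Q.starProjection v‖ = 0
  · simp [h]
  · rw [sq, mul_div_mul_right _ _ h]

theorem cosSqAngle_eq (P Q : Submodule ℝ V) (v : P) :
    cosSqAngle P Q v = ‖Q.starProjection (v : V)‖ ^ 2 / ‖(v : V)‖ ^ 2 := by
  rw [cosSqAngle, cos_angle_starProjection, div_pow]

theorem critical_iff (P Q : Submodule ℝ V) {u : P} (hu : u ≠ 0) :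
    HasFDerivAt (cosSqAngle P Q) (0 : P →L[ℝ] ℝ) u ↔
      P.starProjection (Q.starProjection (u : V)) = cosSqAngle P Q u • (u : V) := by
  have hn : ‖(u : V)‖ ^ 2 ≠ 0 := by simpa using hu
  have h1 : HasFDerivAt (fun v : P => ‖(v : V)‖ ^ 2) _ u :=
    (P.subtypeL.hasFDerivAt (x := u)).norm_sq
  have h2 : HasFDerivAt (fun v : P => ‖Q.starProjection (v : V)‖ ^ 2) _ u :=
    ((Q.starProjection.comp P.subtypeL).hasFDerivAt (x := u)).norm_sq
  have hd : DifferentiableAt ℝ (cosSqAngle P Q) u := by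
    rw [show cosSqAngle P Q = fun v : P => ‖Q.starProjection (v : V)‖ ^ 2 / ‖(v : V)‖ ^ 2 from
      funext (cosSqAngle_eq P Q)]
    simp only [div_eq_mul_inv]
    exact h2.differentiableAt.fun_mul (h1.differentiableAt.fun_inv hn)
  obtain ⟨L, hL⟩ := hd
  have h3 := hL.fun_mul h1
  rw [show (fun v : P => cosSqAngle P Q v * ‖(v : V)‖ ^ 2) =
      fun v : P => ‖Q.starProjection (v : V)‖ ^ 2 from by
    funext v
    rw [cosSqAngle_eq]
    by_cases hv : ‖(v : V)‖ = 0
    · have hv' : (v : V) = 0 := by simpa using hv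
      simp [hv']
    · field_simp] at h3
  have key : ∀ h : P, 2 * inner ℝ (P.starProjection (Q.starProjection (u : V)) -
      cosSqAngle P Q u • (u : V)) (h : V) = ‖(u : V)‖ ^ 2 * L h := by
    intro h
    have e := DFunLike.congr_fun (h3.unique h2) h
    simp only [add_apply, smul_apply,
      ContinuousLinearMap.comp_apply, Submodule.subtypeL_apply, innerSL_apply_apply,
      smul_eq_mul, nsmul_eq_mul] at e
    rw [inner_sub_left, inner_smul_left, Submodule.inner_starProjection_left_eq_right,
      Submodule.starProjection_eq_self_iff.2 h.2, Submodule.inner_starProjection_left_eq_right,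
      ← inner_starProjection_self]
    simp only [conj_trivial]
    push_cast at e
    linarith
  constructor
  · intro h0
    have hL0 : L = 0 := hL.unique h0
    set w := P.starProjection (Q.starProjection (u : V)) - cosSqAngle P Q u • (u : V) with hw
    have hwP : w ∈ P :=
      P.sub_mem (Submodule.starProjection_apply_mem P _) (P.smul_mem _ u.2)
    have hz := key ⟨w, hwP⟩
    rw [hL0] at hz
    have hww : inner ℝ w w = (0 : ℝ) := by simpa using hz
    exact sub_eq_zero.1 (inner_self_eq_zero.1 hww)
  · intro h0
    have hL0 : L = 0 := by
      ext h
      have hz := key h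
      rw [h0, sub_self, inner_zero_left, mul_zero] at hz
      simpa [hn] using hz.symm
    rwa [hL0] at hL

/-- The angle directions are the nonzero vectors of the angle space. -/
theorem isAngleDirection_iff (P Q : Submodule ℝ V) {θ : ℝ}
    (hθ : θ ∈ Set.Icc 0 (Real.pi / 2)) (u : P) :
    IsAngleDirection P Q θ u ↔ u ≠ 0 ∧ (u : V) ∈ angleSpace P Q θ := by
  constructor
  · rintro ⟨hu, ha, hc⟩
    refine ⟨hu, u.2, ?_⟩
    rw [(critical_iff P Q hu).1 hc, cosSqAngle, ha]
  · rintro ⟨hu, -, he⟩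
    have hn : (0 : ℝ) < ‖(u : V)‖ := by simpa using hu
    have hsq : cosSqAngle P Q u = Real.cos θ ^ 2 := by
      have h := congrArg (fun w => inner ℝ w (u : V)) he
      simp only [inner_smul_left, conj_trivial, Submodule.inner_starProjection_left_eq_right,
        Submodule.starProjection_eq_self_iff.2 u.2, real_inner_self_eq_norm_sq] at h
      rw [← inner_starProjection_self, real_inner_self_eq_norm_sq] at h
      rw [cosSqAngle_eq, h]
      field_simp
    refine ⟨hu, ?_, (critical_iff P Q hu).2 (by rw [he, hsq])⟩
    have h0 : 0 ≤ Real.cos θ :=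
      Real.cos_nonneg_of_mem_Icc ⟨by linarith [hθ.1, Real.pi_pos], hθ.2⟩
    have h1 : 0 ≤ Real.cos (InnerProductGeometry.angle (u : V) (Q.starProjection (u : V))) := by
      rw [cos_angle_starProjection]
      positivity
    have h2 := (sq_eq_sq₀ h1 h0).1 hsq
    exact Real.injOn_cos ⟨InnerProductGeometry.angle_nonneg _ _,
      InnerProductGeometry.angle_le_pi _ _⟩ ⟨hθ.1, by linarith [hθ.2, Real.pi_pos]⟩ h2

theorem jordanAngles_subset (P Q : Submodule ℝ V) :
    jordanAngles P Q ⊆ Set.Icc 0 (Real.pi / 2) := by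
  rintro θ ⟨u, -, rfl, -⟩
  refine ⟨InnerProductGeometry.angle_nonneg _ _, ?_⟩
  rw [InnerProductGeometry.angle, Real.arccos_le_pi_div_two, ← inner_starProjection_self]
  exact div_nonneg real_inner_self_nonneg (by positivity)

/-- `θ` is a Jordan angle if and only if `cos² θ` is an eigenvalue of `𝒫 ∘ 𝒫₀` on `P`. -/
theorem mem_jordanAngles_iff (P Q : Submodule ℝ V) (θ : ℝ) :
    θ ∈ jordanAngles P Q ↔ θ ∈ Set.Icc 0 (Real.pi / 2) ∧ angleSpace P Q θ ≠ ⊥ := by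
  constructor
  · intro h
    have hθ := jordanAngles_subset P Q h
    obtain ⟨u, hu⟩ := h
    have h' := (isAngleDirection_iff P Q hθ u).1 hu
    refine ⟨hθ, fun hb => h'.1 ?_⟩
    have h2 := h'.2
    rw [hb, Submodule.mem_bot] at h2
    exact Subtype.ext h2
  · rintro ⟨hθ, hne⟩
    obtain ⟨u, hu, hu0⟩ := Submodule.exists_mem_ne_zero_of_ne_bot hne
    exact ⟨⟨u, hu.1⟩, (isAngleDirection_iff P Q hθ _).2 ⟨by simpa using hu0, hu⟩⟩

end Angles

section Graph

variable {n m : ℕ}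

/-- `ℝⁿ⁺ᵐ = ℝⁿ × ℝᵐ` with its Euclidean inner product: the coordinates `Sum.inl i` are those of
`ℝⁿ`, the coordinates `Sum.inr j` those of `ℝᵐ`. -/
abbrev Ambient (n m : ℕ) : Type := EuclideanSpace ℝ (Fin n ⊕ Fin m)

/-- The first component `ℝⁿ × ℝᵐ → ℝⁿ`. -/
def baseProj (n m : ℕ) : Ambient n m →ₗ[ℝ] EuclideanSpace ℝ (Fin n) where
  toFun p := WithLp.toLp 2 fun i => p (Sum.inl i)
  map_add' _ _ := rfl
  map_smul' _ _ := rfl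

/-- The coordinate `m`-plane `{0} × ℝᵐ`. -/
def coordPlane (n m : ℕ) : Submodule ℝ (Ambient n m) := LinearMap.ker (baseProj n m)

/-- The map `x ↦ (x, f x)`. -/
def graphMap (f : EuclideanSpace ℝ (Fin n) → EuclideanSpace ℝ (Fin m))
    (x : EuclideanSpace ℝ (Fin n)) : Ambient n m :=
  WithLp.toLp 2 (Sum.elim (fun i => x i) (fun j => f x j))

/-- The tangent `n`-plane of `graph f` at `(x, f x)`. -/
def tangentPlane (f : EuclideanSpace ℝ (Fin n) → EuclideanSpace ℝ (Fin m))
    (x : EuclideanSpace ℝ (Fin n)) : Submodule ℝ (Ambient n m) :=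
  LinearMap.range (fderiv ℝ (graphMap f) x).toLinearMap

/-- The normal `m`-plane of `graph f` at `(x, f x)`. -/
def normalPlane (f : EuclideanSpace ℝ (Fin n) → EuclideanSpace ℝ (Fin m))
    (x : EuclideanSpace ℝ (Fin n)) : Submodule ℝ (Ambient n m) := (tangentPlane f x)ᗮ

/-- The second fundamental form `B_{XY} = (∇̄_X Y)ᴺ` of `graph f` at `(x, f x)`, for tangent vectors
`X`, `Y`, which are the images under `d(graphMap f)_x` of their first components. The vector `Y` is
extended to the tangent vector field `d(graphMap f) (baseProj Y)` along the graph, and this field is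
differentiated in the direction of `X`. -/
def secondFundamentalForm (f : EuclideanSpace ℝ (Fin n) → EuclideanSpace ℝ (Fin m))
    (x : EuclideanSpace ℝ (Fin n)) (X Y : tangentPlane f x) : Ambient n m :=
  (normalPlane f x).starProjection
    (fderiv ℝ (fun y => fderiv ℝ (graphMap f) y (baseProj n m Y)) x (baseProj n m X))

/-- The mean curvature vector of `graph f` at `(x, f x)`: the trace of the second fundamental form,
computed in an orthonormal basis of the tangent plane. -/
def meanCurvature (f : EuclideanSpace ℝ (Fin n) → EuclideanSpace ℝ (Fin m))
    (x : EuclideanSpace ℝ (Fin n)) : Ambient n m :=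
  ∑ i, secondFundamentalForm f x (stdOrthonormalBasis ℝ (tangentPlane f x) i)
    (stdOrthonormalBasis ℝ (tangentPlane f x) i)

/-- The graph of `f` over `D` is a minimal submanifold. -/
def IsMinimalGraph (f : EuclideanSpace ℝ (Fin n) → EuclideanSpace ℝ (Fin m))
    (D : Set (EuclideanSpace ℝ (Fin n))) : Prop := ∀ x ∈ D, meanCurvature f x = 0

/-- `Arg(N_p M, Q)`, the normal Jordan angles of `M = graph f` at `p = (x, f x)`. -/
def normalJordanAngles (f : EuclideanSpace ℝ (Fin n) → EuclideanSpace ℝ (Fin m))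
    (Q : Submodule ℝ (Ambient n m)) (x : EuclideanSpace ℝ (Fin n)) : Set ℝ :=
  jordanAngles (normalPlane f x) Q

/-- `Arg(T_p M, Qᗮ)`, the tangent Jordan angles of `M = graph f` at `p = (x, f x)`. -/
def tangentJordanAngles (f : EuclideanSpace ℝ (Fin n) → EuclideanSpace ℝ (Fin m))
    (Q : Submodule ℝ (Ambient n m)) (x : EuclideanSpace ℝ (Fin n)) : Set ℝ :=
  jordanAngles (tangentPlane f x) Qᗮ

/-- The graph of `f` over `D` has constant Jordan angles (CJA) relative to `Q`: neither the set of
the normal Jordan angles nor their multiplicities depend on the point. -/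
def HasConstantJordanAngles (f : EuclideanSpace ℝ (Fin n) → EuclideanSpace ℝ (Fin m))
    (D : Set (EuclideanSpace ℝ (Fin n))) (Q : Submodule ℝ (Ambient n m)) : Prop :=
  ∀ x ∈ D, ∀ y ∈ D, normalJordanAngles f Q x = normalJordanAngles f Q y ∧
    ∀ θ ∈ normalJordanAngles f Q x,
      multiplicity (normalPlane f x) Q θ = multiplicity (normalPlane f y) Q θ

end Graph

end JordanAngles

end

/-!
Write `A = Df`, `B = D²f`, `G = A† A` and `H = A A†`. The tangents of the tangent and normal Jordan
angles of the graph relative to the coordinate planes are the singular values of `A` and of `A†`, so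
the squared tangents are the eigenvalues of `G` and `H`, whose nonzero eigenvalues agree. The
hypotheses on the angles therefore yield constants `a > 0`, `b ≥ 0`, `a ≠ b`, such that all
eigenvalues of `G` and `H` lie in `{a, b}` over the whole of `D` (`exists_gramEigenvalues`; if there
is at most one nonzero eigenvalue, then `b = 0`).

In an orthonormal eigenbasis `e i` of `G` at a point, differentiating `(G - a) (G - b) = 0` gives
`⟪B v (e i), A (e j)⟫ + ⟪A (e i), B v (e j)⟫ = 0` for `e i`, `e j` in the same eigenspace
(`inner_deriv_add_eq_zero`). As `B` is symmetric, `⟪B (e i) (e j), A (e k)⟫ = 0` follows for `i`,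
`j`, `k` in the same eigenspace. Moreover `B v (e i)` lies in the range of `A` if `e i` belongs to
the eigenvalue `b`: for `b ≠ 0` because `A` is onto, and for `b = 0` by differentiating
`A A† A = a A` (`deriv_mem_range`). Consequently the traces of `B` over the two eigenspaces are
orthogonal to each other. The minimal surface system says that they sum to zero with the positive
weights `(1 + a)⁻¹` and `(1 + b)⁻¹`, so both vanish (`sum_eq_zero_of_weighted_sum_eq_zero`).

Hence `f` is harmonic for the flat metric of `ℝⁿ`, and `|Df|²`, the trace of `G`, has derivative
zero. Then `0 = Δ (|Df|² / 2) = |D²f|²` (`fderiv_fderiv_eq_zero_of_harmonic`), so that `Df` is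
constant on the connected set `D`.
-/

namespace JordanAngles

open ContinuousLinearMap (adjoint adjoint_inner_left adjoint_inner_right adjoint_adjoint)
open Filter Topology

/-! ### Eigenvalues of Gram operators -/

section Eigenvalues

variable {V W : Type*} [NormedAddCommGroup V] [InnerProductSpace ℝ V]
  [NormedAddCommGroup W] [InnerProductSpace ℝ W]

/-- `c` is an eigenvalue of `A† ∘ A`, that is, the square of a singular value of `A`; the eigenvalue
equation is stated weakly. The eigenvalue `0` is allowed and means that `A` is not injective. -/
def IsGramEigenvalue (A : V →L[ℝ] W) (c : ℝ) : Prop :=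
  ∃ v : V, v ≠ 0 ∧ ∀ w, inner ℝ (A v) (A w) = c * inner ℝ v w

theorem IsGramEigenvalue.nonneg {A : V →L[ℝ] W} {c : ℝ} (h : IsGramEigenvalue A c) : 0 ≤ c := by
  obtain ⟨v, hv, h⟩ := h
  have h1 := h v
  rw [real_inner_self_eq_norm_sq, real_inner_self_eq_norm_sq] at h1
  have h2 : 0 < ‖v‖ ^ 2 := by positivity
  by_contra hc
  nlinarith [sq_nonneg ‖A v‖, mul_neg_of_neg_of_pos (not_le.1 hc) h2]

/-- The trace of a bilinear map over an orthonormal basis does not depend on the basis. -/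
theorem sum_orthonormalBasis_eq {ι κ : Type*} [Fintype ι] [Fintype κ]
    (e : OrthonormalBasis ι ℝ V) (e' : OrthonormalBasis κ ℝ V) (B : V →ₗ[ℝ] V →ₗ[ℝ] W) :
    ∑ i, B (e i) (e i) = ∑ k, B (e' k) (e' k) := by
  have h : ∀ i, B (e i) (e i) = ∑ k, inner ℝ (e' k) (e i) • B (e' k) (e i) := fun i => by
    calc B (e i) (e i) = B (∑ k, inner ℝ (e' k) (e i) • e' k) (e i) := by rw [e'.sum_repr']
      _ = _ := by simp only [map_sum, LinearMap.sum_apply, map_smul, LinearMap.smul_apply]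
  have h' : ∀ k, B (e' k) (e' k) = ∑ i, inner ℝ (e i) (e' k) • B (e' k) (e i) := fun k => by
    calc B (e' k) (e' k) = B (e' k) (∑ i, inner ℝ (e i) (e' k) • e i) := by rw [e.sum_repr']
      _ = _ := by simp only [map_sum, map_smul]
  simp_rw [h, h']
  rw [Finset.sum_comm]
  simp_rw [real_inner_comm]

variable [FiniteDimensional ℝ V] [FiniteDimensional ℝ W]

/-- `A† ∘ A` and `A ∘ A†` have the same nonzero eigenvalues. -/
theorem IsGramEigenvalue.adjoint {A : V →L[ℝ] W} {c : ℝ} (hc : c ≠ 0)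
    (h : IsGramEigenvalue A c) : IsGramEigenvalue (adjoint A) c := by
  obtain ⟨v, hv, h⟩ := h
  have e : ContinuousLinearMap.adjoint A (A v) = c • v := by
    refine ext_inner_right ℝ fun w => ?_
    rw [adjoint_inner_left, h, real_inner_smul_left]
  refine ⟨A v, fun h0 => ?_, fun w => ?_⟩
  · rw [h0, map_zero] at e
    exact (smul_ne_zero hc hv) e.symm
  · rw [e, real_inner_smul_left, adjoint_inner_right]

theorem isGramEigenvalue_adjoint_iff {A : V →L[ℝ] W} {c : ℝ} (hc : c ≠ 0) :
    IsGramEigenvalue (adjoint A) c ↔ IsGramEigenvalue A c :=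
  ⟨fun h => by simpa using h.adjoint hc, fun h => h.adjoint hc⟩

/-- An orthonormal basis in which `A† ∘ A` is diagonal. -/
theorem exists_orthonormalBasis_gram (A : V →L[ℝ] W) :
    ∃ (e : OrthonormalBasis (Fin (Module.finrank ℝ V)) ℝ V) (c : Fin (Module.finrank ℝ V) → ℝ),
      (∀ i, IsGramEigenvalue A (c i)) ∧ ∀ i w, inner ℝ (A (e i)) (A w) = c i * inner ℝ (e i) w := by
  have hs : ((adjoint A ∘L A : V →L[ℝ] V) : V →ₗ[ℝ] V).IsSymmetric := fun v w => by
    simp [adjoint_inner_left, adjoint_inner_right]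
  have key : ∀ i w, inner ℝ (A (hs.eigenvectorBasis rfl i)) (A w) =
      hs.eigenvalues rfl i * inner ℝ (hs.eigenvectorBasis rfl i) w := fun i w => by
    have h : adjoint A (A (hs.eigenvectorBasis rfl i)) =
      hs.eigenvalues rfl i • hs.eigenvectorBasis rfl i := hs.apply_eigenvectorBasis rfl i
    rw [← adjoint_inner_left, h, real_inner_smul_left]
  exact ⟨hs.eigenvectorBasis rfl, hs.eigenvalues rfl,
    fun i => ⟨_, (hs.eigenvectorBasis rfl).toBasis.ne_zero i, key i⟩, key⟩

end Eigenvalues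

/-! ### Jordan angles of a graph and eigenvalues of its Gram operators -/

section GraphGeometry

variable {n m : ℕ}

/-- The inclusion `v ↦ (v, 0)`. -/
noncomputable def inlL (n m : ℕ) : EuclideanSpace ℝ (Fin n) →L[ℝ] Ambient n m :=
  LinearMap.toContinuousLinearMap
    { toFun := fun v => WithLp.toLp 2 (Sum.elim (fun i => v i) fun _ => 0)
      map_add' := fun v w => by ext (i | j) <;> simp
      map_smul' := fun c v => by ext (i | j) <;> simp }

/-- The inclusion `y ↦ (0, y)`. -/
noncomputable def inrL (n m : ℕ) : EuclideanSpace ℝ (Fin m) →L[ℝ] Ambient n m :=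
  LinearMap.toContinuousLinearMap
    { toFun := fun y => WithLp.toLp 2 (Sum.elim (fun _ => 0) fun j => y j)
      map_add' := fun v w => by ext (i | j) <;> simp
      map_smul' := fun c v => by ext (i | j) <;> simp }

theorem inlL_add_inrL (v : EuclideanSpace ℝ (Fin n)) (y : EuclideanSpace ℝ (Fin m)) :
    inlL n m v + inrL n m y = WithLp.toLp 2 (Sum.elim (fun i => v i) (fun j => y j)) := by
  ext (i | j) <;> simp [inlL, inrL]

theorem exists_eq_inlL_add_inrL (u : Ambient n m) : ∃ v y, u = inlL n m v + inrL n m y :=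
  ⟨WithLp.toLp 2 fun i => u (Sum.inl i), WithLp.toLp 2 fun j => u (Sum.inr j), by
    rw [inlL_add_inrL]; ext (i | j) <;> rfl⟩

theorem inner_inlL_add_inrL (v v' : EuclideanSpace ℝ (Fin n)) (y y' : EuclideanSpace ℝ (Fin m)) :
    inner ℝ (inlL n m v + inrL n m y) (inlL n m v' + inrL n m y') =
      inner ℝ v v' + inner ℝ y y' := by
  simp only [inlL_add_inrL, PiLp.inner_apply, Fintype.sum_sum_type]
  rfl

theorem baseProj_inlL_add_inrL (v : EuclideanSpace ℝ (Fin n)) (y : EuclideanSpace ℝ (Fin m)) :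
    baseProj n m (inlL n m v + inrL n m y) = v := by
  rw [inlL_add_inrL]; rfl

theorem graphMap_eq (f : EuclideanSpace ℝ (Fin n) → EuclideanSpace ℝ (Fin m)) :
    graphMap f = fun x => inlL n m x + inrL n m (f x) :=
  funext fun x => (inlL_add_inrL x (f x)).symm

theorem inlL_add_inrL_inj {v v' : EuclideanSpace ℝ (Fin n)} {y y' : EuclideanSpace ℝ (Fin m)} :
    inlL n m v + inrL n m y = inlL n m v' + inrL n m y' ↔ v = v' ∧ y = y' := by
  refine ⟨fun h => ?_, fun h => by rw [h.1, h.2]⟩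
  have hv : v = v' := by
    have := congrArg (baseProj n m) h
    rwa [baseProj_inlL_add_inrL, baseProj_inlL_add_inrL] at this
  subst hv
  refine ⟨rfl, sub_eq_zero.1 (inner_self_eq_zero (𝕜 := ℝ).1 ?_)⟩
  have e := inner_inlL_add_inrL (0 : EuclideanSpace ℝ (Fin n)) 0 (y - y') (y - y')
  rw [map_zero, zero_add, map_sub, sub_eq_zero.2 (add_left_cancel h)] at e
  simpa using e.symm

/-- The graph `{(v, A v)}` of a linear map `A`. -/
noncomputable def linearGraph (A : EuclideanSpace ℝ (Fin n) →L[ℝ] EuclideanSpace ℝ (Fin m)) :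
    Submodule ℝ (Ambient n m) :=
  LinearMap.range (inlL n m + inrL n m ∘L A).toLinearMap

theorem mem_linearGraph {A : EuclideanSpace ℝ (Fin n) →L[ℝ] EuclideanSpace ℝ (Fin m)}
    {u : Ambient n m} : u ∈ linearGraph A ↔ ∃ v, inlL n m v + inrL n m (A v) = u := Iff.rfl

theorem inlL_add_inrL_mem_orthogonal_linearGraph
    {A : EuclideanSpace ℝ (Fin n) →L[ℝ] EuclideanSpace ℝ (Fin m)}
    {v : EuclideanSpace ℝ (Fin n)} {y : EuclideanSpace ℝ (Fin m)} :
    inlL n m v + inrL n m y ∈ (linearGraph A)ᗮ ↔ v = -adjoint A y := by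
  rw [Submodule.mem_orthogonal', ← add_eq_zero_iff_eq_neg]
  constructor
  · intro h
    refine ext_inner_right ℝ fun w => ?_
    have := h _ (mem_linearGraph.2 ⟨w, rfl⟩)
    rwa [inner_inlL_add_inrL, ← adjoint_inner_left, ← inner_add_left, ← inner_zero_left w] at this
  · rintro h _ ⟨w, rfl⟩
    have := inner_inlL_add_inrL v w y (A w)
    rw [← adjoint_inner_left, ← inner_add_left, h, inner_zero_left] at this
    exact this

theorem inlL_add_inrL_mem_coordPlane {v : EuclideanSpace ℝ (Fin n)}
    {y : EuclideanSpace ℝ (Fin m)} : inlL n m v + inrL n m y ∈ coordPlane n m ↔ v = 0 := by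
  rw [coordPlane, LinearMap.mem_ker, baseProj_inlL_add_inrL]

theorem inlL_mem_coordPlane_orthogonal (v : EuclideanSpace ℝ (Fin n)) :
    inlL n m v ∈ (coordPlane n m)ᗮ := by
  rw [Submodule.mem_orthogonal']
  intro u hu
  obtain ⟨w, y, rfl⟩ := exists_eq_inlL_add_inrL u
  rw [inlL_add_inrL_mem_coordPlane] at hu
  simpa [hu] using inner_inlL_add_inrL v w 0 y

theorem starProjection_coordPlane (v : EuclideanSpace ℝ (Fin n)) (y : EuclideanSpace ℝ (Fin m)) :
    (coordPlane n m).starProjection (inlL n m v + inrL n m y) = inrL n m y := by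
  refine Submodule.eq_starProjection_of_mem_orthogonal ?_ ?_
  · simpa using inlL_add_inrL_mem_coordPlane.2 (rfl : (0 : EuclideanSpace ℝ (Fin n)) = 0)
  · simpa using inlL_mem_coordPlane_orthogonal v

theorem starProjection_coordPlane_orthogonal (v : EuclideanSpace ℝ (Fin n))
    (y : EuclideanSpace ℝ (Fin m)) :
    (coordPlane n m)ᗮ.starProjection (inlL n m v + inrL n m y) = inlL n m v := by
  rw [Submodule.starProjection_orthogonal', sub_apply, one_apply_eq_self,
    starProjection_coordPlane, add_sub_cancel_right]

theorem starProjection_eq_iff (P : Submodule ℝ (Ambient n m)) {z u : Ambient n m} (hu : u ∈ P) :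
    P.starProjection z = u ↔ ∀ w ∈ P, inner ℝ z w = inner ℝ u w := by
  constructor
  · rintro rfl w hw
    rw [Submodule.inner_starProjection_left_eq_right, Submodule.starProjection_eq_self_iff.2 hw]
  · intro h
    refine Submodule.eq_starProjection_of_mem_orthogonal hu ?_
    rw [Submodule.mem_orthogonal']
    intro w hw
    rw [inner_sub_left, h w hw, sub_self]

theorem arctan_sqrt_mem_jordanAngles_iff (P Q : Submodule ℝ (Ambient n m)) {c : ℝ} (hc : 0 ≤ c) :
    Real.arctan √c ∈ jordanAngles P Q ↔ ∃ u ∈ P, u ≠ 0 ∧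
      ∀ w ∈ P, (1 + c) * inner ℝ (Q.starProjection u) w = inner ℝ u w := by
  have hpos : 1 + c ≠ 0 := by positivity
  rw [mem_jordanAngles_iff, and_iff_right ⟨Real.arctan_nonneg.2 (Real.sqrt_nonneg c),
    (Real.arctan_lt_pi_div_two _).le⟩, Submodule.ne_bot_iff]
  have hcos : Real.cos (Real.arctan √c) ^ 2 = (1 + c)⁻¹ := by
    rw [Real.cos_sq_arctan, Real.sq_sqrt hc, one_div]
  have key : ∀ u, u ∈ angleSpace P Q (Real.arctan √c) ↔ u ∈ P ∧
      ∀ w ∈ P, (1 + c) * inner ℝ (Q.starProjection u) w = inner ℝ u w := fun u => by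
    change (u ∈ P ∧ P.starProjection (Q.starProjection u) = _) ↔ _
    refine and_congr_right fun hu => ?_
    rw [hcos, starProjection_eq_iff P (P.smul_mem _ hu)]
    refine forall₂_congr fun w _ => ?_
    rw [real_inner_smul_left, eq_inv_mul_iff_mul_eq₀ hpos]
  simp only [key, and_assoc]
  exact exists_congr fun u => and_congr_right fun _ => and_comm

/-- The squared tangents of the tangent Jordan angles `θ < π / 2` of a graph are the eigenvalues of
`A† ∘ A`. -/
theorem arctan_sqrt_mem_jordanAngles_linearGraph
    (A : EuclideanSpace ℝ (Fin n) →L[ℝ] EuclideanSpace ℝ (Fin m)) {c : ℝ} (hc : 0 ≤ c) :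
    Real.arctan √c ∈ jordanAngles (linearGraph A) (coordPlane n m)ᗮ ↔ IsGramEigenvalue A c := by
  rw [arctan_sqrt_mem_jordanAngles_iff _ _ hc]
  have key : ∀ v w, (1 + c) * inner ℝ ((coordPlane n m)ᗮ.starProjection
      (inlL n m v + inrL n m (A v))) (inlL n m w + inrL n m (A w)) =
        inner ℝ (inlL n m v + inrL n m (A v)) (inlL n m w + inrL n m (A w)) ↔
      inner ℝ (A v) (A w) = c * inner ℝ v w := fun v w => by
    have h := inner_inlL_add_inrL v w (0 : EuclideanSpace ℝ (Fin m)) (A w)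
    rw [map_zero, add_zero, inner_zero_left, add_zero] at h
    rw [starProjection_coordPlane_orthogonal, h, inner_inlL_add_inrL]
    constructor <;> intro h' <;> linarith
  constructor
  · rintro ⟨u, hu, hu0, h⟩
    obtain ⟨v, rfl⟩ := mem_linearGraph.1 hu
    refine ⟨v, fun h0 => hu0 (by simp [h0]), fun w => ?_⟩
    exact (key v w).1 (h _ (mem_linearGraph.2 ⟨w, rfl⟩))
  · rintro ⟨v, hv, h⟩
    refine ⟨_, mem_linearGraph.2 ⟨v, rfl⟩, fun h0 => hv ?_, ?_⟩
    · have := congrArg (baseProj n m) h0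
      rwa [baseProj_inlL_add_inrL, map_zero] at this
    · intro w' hw'
      obtain ⟨w, rfl⟩ := mem_linearGraph.1 hw'
      exact (key v w).2 (h w)

/-- The squared tangents of the normal Jordan angles `θ < π / 2` of a graph are the eigenvalues of
`A ∘ A†`. -/
theorem arctan_sqrt_mem_jordanAngles_orthogonal_linearGraph
    (A : EuclideanSpace ℝ (Fin n) →L[ℝ] EuclideanSpace ℝ (Fin m)) {c : ℝ} (hc : 0 ≤ c) :
    Real.arctan √c ∈ jordanAngles (linearGraph A)ᗮ (coordPlane n m) ↔
      IsGramEigenvalue (adjoint A) c := by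
  rw [arctan_sqrt_mem_jordanAngles_iff _ _ hc]
  have hmem : ∀ u : Ambient n m, u ∈ (linearGraph A)ᗮ ↔
      ∃ y, inlL n m (-adjoint A y) + inrL n m y = u := fun u => by
    constructor
    · intro hu
      obtain ⟨v, y, rfl⟩ := exists_eq_inlL_add_inrL u
      exact ⟨y, by rw [inlL_add_inrL_mem_orthogonal_linearGraph.1 hu]⟩
    · rintro ⟨y, rfl⟩
      exact inlL_add_inrL_mem_orthogonal_linearGraph.2 rfl
  have key : ∀ y z, (1 + c) * inner ℝ ((coordPlane n m).starProjection
      (inlL n m (-adjoint A y) + inrL n m y)) (inlL n m (-adjoint A z) + inrL n m z) =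
        inner ℝ (inlL n m (-adjoint A y) + inrL n m y) (inlL n m (-adjoint A z) + inrL n m z) ↔
      inner ℝ (adjoint A y) (adjoint A z) = c * inner ℝ y z := fun y z => by
    have h := inner_inlL_add_inrL (0 : EuclideanSpace ℝ (Fin n)) (-adjoint A z) y z
    rw [map_zero, zero_add, inner_zero_left, zero_add] at h
    rw [starProjection_coordPlane, h, inner_inlL_add_inrL, inner_neg_neg]
    constructor <;> intro h' <;> linarith
  constructor
  · rintro ⟨u, hu, hu0, h⟩
    obtain ⟨y, rfl⟩ := (hmem u).1 hu
    refine ⟨y, fun h0 => hu0 (by simp [h0]), fun z => ?_⟩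
    exact (key y z).1 (h _ ((hmem _).2 ⟨z, rfl⟩))
  · rintro ⟨y, hy, h⟩
    refine ⟨_, (hmem _).2 ⟨y, rfl⟩, fun h0 => hy ?_, ?_⟩
    · refine (inlL_add_inrL_inj.1 (h0.trans ?_ : _ = inlL n m 0 + inrL n m 0)).2
      simp
    · intro w hw
      obtain ⟨z, rfl⟩ := (hmem w).1 hw
      exact (key y z).2 (h z)

theorem arctan_sqrt_injOn : Set.InjOn (fun c => Real.arctan √c) (Set.Ici 0) :=
  fun _ ha _ hb h => (Real.sqrt_inj ha hb).1 (Real.arctan_injective h)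

/-- Constant normal Jordan angles, with at most two distinct normal and tangent Jordan angles, force
all eigenvalues of `A† ∘ A` and `A ∘ A†` into a set `{a, b}` with `a > 0` that does not depend on
the point. -/
theorem exists_gramEigenvalues {X : Type*} {D : Set X} (hne : D.Nonempty)
    (A : X → EuclideanSpace ℝ (Fin n) →L[ℝ] EuclideanSpace ℝ (Fin m))
    (hconst : ∀ x ∈ D, ∀ y ∈ D, jordanAngles (linearGraph (A x))ᗮ (coordPlane n m) =
      jordanAngles (linearGraph (A y))ᗮ (coordPlane n m))
    (hN : ∀ x ∈ D, (jordanAngles (linearGraph (A x))ᗮ (coordPlane n m)).encard ≤ 2)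
    (hT : ∀ x ∈ D, (jordanAngles (linearGraph (A x)) (coordPlane n m)ᗮ).encard ≤ 2) :
    ∃ a b : ℝ, 0 < a ∧ 0 ≤ b ∧ a ≠ b ∧ ∀ x ∈ D,
      (∀ c, IsGramEigenvalue (A x) c → c = a ∨ c = b) ∧
      ∀ c, IsGramEigenvalue (adjoint (A x)) c → c = a ∨ c = b := by
  obtain ⟨x₀, hx₀⟩ := hne
  -- A set of at most two angles leaves no room for a third eigenvalue.
  have pair : ∀ S : Set ℝ, S.encard ≤ 2 → ∀ p q c : ℝ, 0 ≤ p → 0 ≤ q → 0 ≤ c → p ≠ q →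
      Real.arctan √p ∈ S → Real.arctan √q ∈ S → Real.arctan √c ∈ S → c = p ∨ c = q := by
    intro S hS p q c hp hq hc hpq hpS hqS hcS
    by_contra! hcon
    have h3 : ({Real.arctan √c, Real.arctan √p, Real.arctan √q} : Set ℝ).encard = 3 :=
      Set.encard_eq_three.2 ⟨_, _, _, fun h => hcon.1 (arctan_sqrt_injOn hc hp h),
        fun h => hcon.2 (arctan_sqrt_injOn hc hq h), fun h => hpq (arctan_sqrt_injOn hp hq h), rfl⟩
    have hle := Set.encard_le_encard (show ({Real.arctan √c, Real.arctan √p, Real.arctan √q} :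
      Set ℝ) ⊆ S by
        rintro t (rfl | rfl | rfl) <;> assumption)
    rw [h3] at hle
    exact absurd (hle.trans hS) (by decide)
  have hH : ∀ x ∈ D, ∀ c, IsGramEigenvalue (adjoint (A x)) c ↔
      IsGramEigenvalue (adjoint (A x₀)) c := by
    intro x hx c
    by_cases hc : 0 ≤ c
    · rw [← arctan_sqrt_mem_jordanAngles_orthogonal_linearGraph _ hc,
        ← arctan_sqrt_mem_jordanAngles_orthogonal_linearGraph _ hc, hconst x hx x₀ hx₀]
    · exact ⟨fun h => absurd h.nonneg hc, fun h => absurd h.nonneg hc⟩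
  by_cases hpq : ∃ p q, p ≠ 0 ∧ q ≠ 0 ∧ p ≠ q ∧ IsGramEigenvalue (adjoint (A x₀)) p ∧
      IsGramEigenvalue (adjoint (A x₀)) q
  · obtain ⟨p, q, hp0, hq0, hpq, hp, hq⟩ := hpq
    refine ⟨p, q, lt_of_le_of_ne hp.nonneg hp0.symm, hq.nonneg, hpq, fun x hx => ⟨?_, ?_⟩⟩
    · intro c hc
      refine pair _ (hT x hx) p q c hp.nonneg hq.nonneg hc.nonneg hpq ?_ ?_ ?_
      · exact (arctan_sqrt_mem_jordanAngles_linearGraph _ hp.nonneg).2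
          ((isGramEigenvalue_adjoint_iff hp0).1 ((hH x hx p).2 hp))
      · exact (arctan_sqrt_mem_jordanAngles_linearGraph _ hq.nonneg).2
          ((isGramEigenvalue_adjoint_iff hq0).1 ((hH x hx q).2 hq))
      · exact (arctan_sqrt_mem_jordanAngles_linearGraph _ hc.nonneg).2 hc
    · intro c hc
      refine pair _ (hN x hx) p q c hp.nonneg hq.nonneg hc.nonneg hpq ?_ ?_ ?_
      · exact (arctan_sqrt_mem_jordanAngles_orthogonal_linearGraph _ hp.nonneg).2
          ((hH x hx p).2 hp)
      · exact (arctan_sqrt_mem_jordanAngles_orthogonal_linearGraph _ hq.nonneg).2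
          ((hH x hx q).2 hq)
      · exact (arctan_sqrt_mem_jordanAngles_orthogonal_linearGraph _ hc.nonneg).2 hc
  · push Not at hpq
    obtain ⟨p, hp, hall⟩ : ∃ p : ℝ, 0 < p ∧
        ∀ c, IsGramEigenvalue (adjoint (A x₀)) c → c = p ∨ c = 0 := by
      by_cases hp : ∃ p, p ≠ 0 ∧ IsGramEigenvalue (adjoint (A x₀)) p
      · obtain ⟨p, hp0, hp⟩ := hp
        refine ⟨p, lt_of_le_of_ne hp.nonneg hp0.symm, fun c hc => ?_⟩
        by_contra! hcon
        exact hpq c p hcon.2 hp0 hcon.1 hc hp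
      · push Not at hp
        exact ⟨1, one_pos, fun c hc => Or.inr (by_contra fun h => hp c h hc)⟩
    refine ⟨p, 0, hp, le_rfl, hp.ne', fun x hx =>
      ⟨fun c hc => ?_, fun c hc => hall c ((hH x hx c).1 hc)⟩⟩
    by_cases hc0 : c = 0
    · exact Or.inr hc0
    · exact hall c ((hH x hx c).1 (hc.adjoint hc0))

end GraphGeometry

/-! ### First-order consequences of having two eigenvalues -/

section TwoEigenvalues

variable {V W : Type*} [NormedAddCommGroup V] [InnerProductSpace ℝ V]
  [NormedAddCommGroup W] [InnerProductSpace ℝ W]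

theorem hasDerivAt_apply_const {γ : ℝ → V →L[ℝ] W} {γ' : V →L[ℝ] W} (hγ : HasDerivAt γ γ' 0)
    (u : V) : HasDerivAt (fun t => γ t u) (γ' u) 0 :=
  ((ContinuousLinearMap.apply ℝ W u).hasFDerivAt.comp_hasDerivAt (0 : ℝ) hγ :)

/-- The traces of `B` over the two eigenspaces of `A† ∘ A` are orthogonal, so that the vanishing of
a combination of them with positive coefficients forces both to vanish. -/
theorem sum_eq_zero_of_weighted_sum_eq_zero {A : V →L[ℝ] W} {B : V →L[ℝ] V →L[ℝ] W}
    (hB : ∀ u v, B u v = B v u) {ι : Type*} [Fintype ι] (e : OrthonormalBasis ι ℝ V)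
    {c : ι → ℝ} {a b : ℝ} (ha : 0 < a) (hb : 0 ≤ b) (hc : ∀ i, c i = a ∨ c i = b)
    (he : ∀ i w, inner ℝ (A (e i)) (A w) = c i * inner ℝ (e i) w)
    (hfst : ∀ v i j, c i = c j →
      inner ℝ (B v (e i)) (A (e j)) + inner ℝ (A (e i)) (B v (e j)) = 0)
    (hrange : ∀ v i, c i = b → ∃ z, A z = B v (e i))
    (hmin : ∑ i, (1 + c i)⁻¹ • B (e i) (e i) = 0) : ∑ i, B (e i) (e i) = 0 := by
  classical
  -- Skew symmetry in the outer pair and symmetry in the inner pair of indices.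
  have hskew : ∀ i j k, c i = c j → c j = c k → inner ℝ (B (e i) (e j)) (A (e k)) = 0 := by
    intro i j k hij hjk
    have h1 := hfst (e i) j k hjk
    have h2 := hfst (e j) k i (hjk.symm.trans hij.symm)
    have h3 := hfst (e k) i j hij
    rw [real_inner_comm] at h1 h2 h3
    rw [hB (e k) (e i)] at h3
    rw [hB (e k) (e j)] at h3
    rw [hB (e j) (e i)] at h2
    have c1 := real_inner_comm (A (e j)) (B (e i) (e k))
    have c2 := real_inner_comm (A (e k)) (B (e i) (e j))
    have c3 := real_inner_comm (A (e i)) (B (e j) (e k))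
    linarith
  have horth : ∀ i k, c i = a → c k ≠ a → inner ℝ (B (e i) (e i)) (B (e k) (e k)) = 0 := by
    intro i k hi hk
    have hkb : c k = b := (hc k).resolve_left hk
    obtain ⟨z, hz⟩ := hrange (e k) k hkb
    rw [← hz, ← e.sum_repr' z, map_sum, inner_sum]
    refine Finset.sum_eq_zero fun l _ => ?_
    rw [map_smul, real_inner_smul_right]
    rcases eq_or_ne (c l) a with hl | hl
    · rw [hskew i i l rfl (hi.trans hl.symm), mul_zero]
    · have hlb : c l = b := (hc l).resolve_left hl
      have h1 := hskew k k l rfl (hkb.trans hlb.symm)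
      rw [← hz, real_inner_comm, he] at h1
      rcases mul_eq_zero.1 h1 with h0 | h0
      · have : A (e l) = 0 := inner_self_eq_zero (𝕜 := ℝ).1 (by rw [he, h0, zero_mul])
        rw [this, inner_zero_right, mul_zero]
      · rw [h0, zero_mul]
  set U := ∑ i with c i = a, B (e i) (e i) with hU
  set T := ∑ i with c i ≠ a, B (e i) (e i) with hT
  have hUT : inner ℝ U T = (0 : ℝ) := by
    rw [hU, hT, sum_inner]
    refine Finset.sum_eq_zero fun i hi => ?_
    rw [inner_sum]
    exact Finset.sum_eq_zero fun k hk =>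
      horth i k (Finset.mem_filter.1 hi).2 (Finset.mem_filter.1 hk).2
  have hw : (1 + a)⁻¹ • U + (1 + b)⁻¹ • T = 0 := by
    rw [← hmin, ← Finset.sum_filter_add_sum_filter_not Finset.univ (fun i => c i = a), hU, hT,
      Finset.smul_sum, Finset.smul_sum]
    congr 1
    · exact Finset.sum_congr rfl fun i hi => by rw [(Finset.mem_filter.1 hi).2]
    · exact Finset.sum_congr rfl fun i hi => by
        rw [(hc i).resolve_left (Finset.mem_filter.1 hi).2]
  have hU0 : U = 0 := by
    have h := congrArg (fun z => inner ℝ U z) hw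
    simp only [inner_add_right, real_inner_smul_right, hUT, mul_zero, add_zero,
      inner_zero_right] at h
    exact inner_self_eq_zero (𝕜 := ℝ).1 ((mul_eq_zero.1 h).resolve_left (by positivity))
  have hT0 : T = 0 := by
    rw [hU0, smul_zero, zero_add] at hw
    exact (smul_eq_zero.1 hw).resolve_left (by positivity)
  rw [← Finset.sum_filter_add_sum_filter_not Finset.univ (fun i => c i = a), ← hU, ← hT, hU0, hT0,
    add_zero]

variable [FiniteDimensional ℝ V] [FiniteDimensional ℝ W]

theorem gram_gram {A : V →L[ℝ] W} {a b : ℝ} (hA : ∀ c, IsGramEigenvalue A c → c = a ∨ c = b)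
    (u : V) : adjoint A (A (adjoint A (A u))) = (a + b) • adjoint A (A u) - (a * b) • u := by
  obtain ⟨e, c, hc, he⟩ := exists_orthonormalBasis_gram A
  have heig : ∀ i, adjoint A (A (e i)) = c i • e i := fun i => by
    refine ext_inner_right ℝ fun w => ?_
    rw [adjoint_inner_left, he, real_inner_smul_left]
  have h : ((adjoint A ∘L A ∘L adjoint A ∘L A : V →L[ℝ] V) : V →ₗ[ℝ] V) =
      (((a + b) • (adjoint A ∘L A) - (a * b) • ContinuousLinearMap.id ℝ V : V →L[ℝ] V) :
        V →ₗ[ℝ] V) := by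
    refine e.toBasis.ext fun i => ?_
    have : adjoint A (A (adjoint A (A (e i)))) =
        (a + b) • adjoint A (A (e i)) - (a * b) • e i := by
      simp only [heig, map_smul, smul_smul, ← sub_smul]
      congr 1
      rcases hA _ (hc i) with h | h <;> rw [h] <;> ring
    simpa using this
  exact DFunLike.congr_fun h u

theorem inner_gram_gram {A : V →L[ℝ] W} {a b : ℝ}
    (hA : ∀ c, IsGramEigenvalue A c → c = a ∨ c = b) {ι : Type*} [Fintype ι]
    (e : OrthonormalBasis ι ℝ V) (u w : V) :
    ∑ l, inner ℝ (A u) (A (e l)) * inner ℝ (A (e l)) (A w) =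
      (a + b) * inner ℝ (A u) (A w) - a * b * inner ℝ u w := by
  have h := e.sum_inner_mul_inner (adjoint A (A u)) (adjoint A (A w))
  simp only [adjoint_inner_left, adjoint_inner_right] at h
  rw [h, ← adjoint_inner_left, gram_gram hA, inner_sub_left,
    real_inner_smul_left, real_inner_smul_left, adjoint_inner_left]

/-- The identity `A A† A = a A`, with `A†` written out in the basis `e`; for `a > 0` it says that
`A / √a` is a partial isometry. -/
theorem apply_gram {A : V →L[ℝ] W} {a : ℝ} (hA : ∀ c, IsGramEigenvalue A c → c = a ∨ c = 0)
    {ι : Type*} [Fintype ι] (e : OrthonormalBasis ι ℝ V) (u : V) :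
    ∑ l, inner ℝ (A u) (A (e l)) • A (e l) = a • A u := by
  have h : adjoint A (A (adjoint A (A u) - a • u)) = 0 := by
    simp [gram_gram hA u]
  have h2 : A (adjoint A (A u) - a • u) = 0 := by
    refine inner_self_eq_zero (𝕜 := ℝ).1 ?_
    rw [← adjoint_inner_left, h, inner_zero_left]
  rw [map_sub, sub_eq_zero, map_smul] at h2
  rw [← h2, ← e.sum_repr' (adjoint A (A u))]
  simp only [map_sum, map_smul, adjoint_inner_right]
  exact Finset.sum_congr rfl fun l _ => by rw [real_inner_comm]

theorem surjective_of_gramEigenvalues {A : V →L[ℝ] W} {a b : ℝ} (ha : a ≠ 0) (hb : b ≠ 0)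
    (hA : ∀ c, IsGramEigenvalue (adjoint A) c → c = a ∨ c = b) : Function.Surjective A := by
  intro y
  have h := gram_gram hA y
  rw [adjoint_adjoint] at h
  refine ⟨(a * b)⁻¹ • ((a + b) • adjoint A y - adjoint A (A (adjoint A y))), ?_⟩
  rw [map_smul, map_sub, map_smul, h, sub_sub_cancel, smul_smul,
    inv_mul_cancel₀ (mul_ne_zero ha hb), one_smul]

/-- Along a curve of linear maps whose Gram eigenvalues stay in `{a, b}`, the derivative of the Gram
form has no component on an eigenspace. It is the derivative of `(G - a) (G - b) = 0`. -/
theorem inner_deriv_add_eq_zero {γ : ℝ → V →L[ℝ] W} {γ' : V →L[ℝ] W} (hγ : HasDerivAt γ γ' 0)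
    {a b : ℝ} (hab : a ≠ b)
    (hev : ∀ᶠ t in 𝓝 0, ∀ c, IsGramEigenvalue (γ t) c → c = a ∨ c = b)
    {ι : Type*} [Fintype ι] (e : OrthonormalBasis ι ℝ V) (c : ι → ℝ)
    (hc : ∀ i, c i = a ∨ c i = b)
    (he : ∀ i w, inner ℝ (γ 0 (e i)) (γ 0 w) = c i * inner ℝ (e i) w) {i j : ι}
    (hij : c i = c j) :
    inner ℝ (γ' (e i)) (γ 0 (e j)) + inner ℝ (γ 0 (e i)) (γ' (e j)) = 0 := by
  classical
  have hd : ∀ p q, HasDerivAt (fun t => inner ℝ (γ t (e p)) (γ t (e q)))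
      (inner ℝ (γ 0 (e p)) (γ' (e q)) + inner ℝ (γ' (e p)) (γ 0 (e q))) 0 := fun p q =>
    (hasDerivAt_apply_const hγ (e p)).inner ℝ (hasDerivAt_apply_const hγ (e q))
  have h1 := HasDerivAt.fun_sum (u := Finset.univ) fun l _ => (hd i l).fun_mul (hd l j)
  have h2 := ((hd i j).const_mul (a + b)).sub_const (a * b * inner ℝ (e i) (e j))
  have heq := h1.unique (h2.congr_of_eventuallyEq
    (hev.mono fun t ht => inner_gram_gram ht e (e i) (e j)))
  have hon : ∀ p q, inner ℝ (γ 0 (e p)) (γ 0 (e q)) = if p = q then c p else 0 := fun p q => by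
    rw [he, orthonormal_iff_ite.1 e.orthonormal]
    simp
  simp only [hon, mul_ite, ite_mul, mul_zero, zero_mul, Finset.sum_add_distrib,
    Finset.sum_ite_eq, Finset.sum_ite_eq', Finset.mem_univ, if_true, hij] at heq
  have hne : 2 * c j - (a + b) ≠ 0 := by
    rcases hc j with h | h <;> rw [h]
    · exact fun h0 => hab (by linarith)
    · exact fun h0 => hab (by linarith)
  refine (mul_eq_zero.1 (?_ : (2 * c j - (a + b)) * _ = 0)).resolve_left hne
  linarith

/-- Along a curve of linear maps with Gram eigenvalues in `{a, 0}`, the derivative maps the kernel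
into the range. It follows by differentiating `A A† A = a A`. -/
theorem deriv_mem_range {γ : ℝ → V →L[ℝ] W} {γ' : V →L[ℝ] W} (hγ : HasDerivAt γ γ' 0)
    {a : ℝ} (ha : a ≠ 0)
    (hev : ∀ᶠ t in 𝓝 0, ∀ c, IsGramEigenvalue (γ t) c → c = a ∨ c = 0) {u : V}
    (hu : γ 0 u = 0) : ∃ z, γ 0 z = γ' u := by
  have e := stdOrthonormalBasis ℝ V
  have hd := fun v => hasDerivAt_apply_const hγ v
  have h1 := HasDerivAt.fun_sum (u := Finset.univ) fun l _ =>
    ((hd u).inner ℝ (hd (e l))).smul (hd (e l))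
  have h2 := (hd u).const_smul a
  have heq := h1.unique (h2.congr_of_eventuallyEq (hev.mono fun t ht => apply_gram ht e u))
  simp only [hu, inner_zero_left, zero_smul, zero_add] at heq
  refine ⟨a⁻¹ • ∑ l, inner ℝ (γ' u) (γ 0 (e l)) • e l, ?_⟩
  rw [map_smul, map_sum]
  simp only [map_smul]
  rw [heq, smul_smul, inv_mul_cancel₀ ha, one_smul]

end TwoEigenvalues

/-! ### Harmonic maps with differential of constant norm -/

section Harmonic

variable {V W : Type*} [NormedAddCommGroup V] [InnerProductSpace ℝ V]
  [NormedAddCommGroup W] [InnerProductSpace ℝ W]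

theorem hasFDerivAt_apply_const {E F G : Type*} [NormedAddCommGroup E] [NormedSpace ℝ E]
    [NormedAddCommGroup F] [NormedSpace ℝ F] [NormedAddCommGroup G] [NormedSpace ℝ G]
    {L : E → F →L[ℝ] G} {L' : E →L[ℝ] F →L[ℝ] G} {x : E} (h : HasFDerivAt L L' x) (u : F) :
    HasFDerivAt (fun y => L y u) ((ContinuousLinearMap.apply ℝ G u).comp L') x :=
  (ContinuousLinearMap.apply ℝ G u).hasFDerivAt.comp x h

/-- A harmonic map into a Euclidean space whose differential has constant norm has vanishing second
derivative: `0 = Δ (|Df|² / 2) = |D²f|²`. The constancy of the norm enters through its vanishing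
derivative. -/
theorem fderiv_fderiv_eq_zero_of_harmonic {f : V → W} {D : Set V} (hD : IsOpen D)
    (hf : ContDiffOn ℝ ∞ f D) {ι : Type*} [Fintype ι] (e : OrthonormalBasis ι ℝ V)
    (hharm : ∀ x ∈ D, ∑ i, fderiv ℝ (fderiv ℝ f) x (e i) (e i) = 0)
    (henergy : ∀ x ∈ D, ∀ v,
      ∑ i, inner ℝ (fderiv ℝ (fderiv ℝ f) x v (e i)) (fderiv ℝ f x (e i)) = 0) :
    ∀ x ∈ D, fderiv ℝ (fderiv ℝ f) x = 0 := by
  intro x hx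
  have hf1 : ContDiffOn ℝ ∞ (fderiv ℝ f) D := hf.fderiv_of_isOpen hD (by simp)
  have hf2 : ContDiffOn ℝ ∞ (fderiv ℝ (fderiv ℝ f)) D := hf1.fderiv_of_isOpen hD (by simp)
  have hDx : D ∈ 𝓝 x := hD.mem_nhds hx
  have htwo : minSmoothness ℝ 2 ≤ (∞ : WithTop ℕ∞) := by
    rw [minSmoothness_of_isRCLikeNormedField]
    exact WithTop.coe_le_coe.2 le_top
  have hsymm : ∀ y ∈ D, IsSymmSndFDerivAt ℝ f y := fun y hy =>
    (hf.contDiffAt (hD.mem_nhds hy)).isSymmSndFDerivAt htwo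
  have hsymm1 : IsSymmSndFDerivAt ℝ (fderiv ℝ f) x :=
    (hf1.contDiffAt hDx).isSymmSndFDerivAt htwo
  have d1 : HasFDerivAt (fderiv ℝ f) (fderiv ℝ (fderiv ℝ f) x) x :=
    ((hf1.contDiffAt hDx).differentiableAt (by simp)).hasFDerivAt
  have d2 : HasFDerivAt (fderiv ℝ (fderiv ℝ f)) (fderiv ℝ (fderiv ℝ (fderiv ℝ f)) x) x :=
    ((hf2.contDiffAt hDx).differentiableAt (by simp)).hasFDerivAt
  set A := fderiv ℝ f
  set B := fderiv ℝ A
  set C := fderiv ℝ B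
  have dA : ∀ u, HasFDerivAt (fun y => A y u) _ x := fun u => hasFDerivAt_apply_const d1 u
  have dB : ∀ u v, HasFDerivAt (fun y => B y u v) _ x := fun u v =>
    hasFDerivAt_apply_const (hasFDerivAt_apply_const d2 u) v
  have hC1 : ∀ u v w, C x u v w = C x u w v := fun u v w => by
    have h : (fun y => B y v w) =ᶠ[𝓝 x] fun y => B y w v :=
      Filter.eventually_of_mem hDx fun y hy => hsymm y hy v w
    exact DFunLike.congr_fun ((dB v w).unique ((dB w v).congr_of_eventuallyEq h)) u
  have hC2 : ∀ u v w, C x u v w = C x v u w := fun u v w =>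
    DFunLike.congr_fun (hsymm1 u v) w
  have hlap : ∀ u, ∑ i, C x u (e i) (e i) = 0 := fun u => by
    have h : (fun y => ∑ i, B y (e i) (e i)) =ᶠ[𝓝 x] fun _ => 0 :=
      Filter.eventually_of_mem hDx fun y hy => hharm y hy
    have := DFunLike.congr_fun ((HasFDerivAt.fun_sum (u := Finset.univ)
      fun i _ => dB (e i) (e i)).unique ((hasFDerivAt_const 0 x).congr_of_eventuallyEq h)) u
    simpa using this
  have hen : ∀ k, ∑ i, (inner ℝ (C x (e k) (e k) (e i)) (A x (e i)) +
      ‖B x (e k) (e i)‖ ^ 2) = 0 := fun k => by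
    have h : (fun y => ∑ i, inner ℝ (B y (e k) (e i)) (A y (e i))) =ᶠ[𝓝 x] fun _ => 0 :=
      Filter.eventually_of_mem hDx fun y hy => henergy y hy (e k)
    have := DFunLike.congr_fun ((HasFDerivAt.fun_sum (u := Finset.univ)
      fun i _ => (dB (e k) (e i)).inner ℝ (dA (e i))).unique
        ((hasFDerivAt_const 0 x).congr_of_eventuallyEq h)) (e k)
    simpa [add_comm] using this
  have hsum : ∑ k, ∑ i, ‖B x (e k) (e i)‖ ^ 2 = 0 := by
    have h : ∑ k, ∑ i, (inner ℝ (C x (e k) (e k) (e i)) (A x (e i)) +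
      ‖B x (e k) (e i)‖ ^ 2) = 0 := Finset.sum_eq_zero fun k _ => hen k
    have h0 : ∑ k, ∑ i, inner ℝ (C x (e k) (e k) (e i)) (A x (e i)) = 0 := by
      rw [Finset.sum_comm]
      refine Finset.sum_eq_zero fun i _ => ?_
      rw [← sum_inner, ← inner_zero_left (A x (e i)), ← hlap (e i)]
      exact congrArg (fun z => inner ℝ z _) (Finset.sum_congr rfl fun k _ => by
        rw [hC1 (e k), hC2 (e k)])
    simp only [Finset.sum_add_distrib] at h
    rwa [h0, zero_add] at h
  have hz : ∀ k i, B x (e k) (e i) = 0 := fun k i => by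
    have h1 := (Finset.sum_eq_zero_iff_of_nonneg fun k _ =>
      Finset.sum_nonneg fun i _ => sq_nonneg ‖B x (e k) (e i)‖).1 hsum k (Finset.mem_univ k)
    have h2 := (Finset.sum_eq_zero_iff_of_nonneg fun i _ =>
      sq_nonneg ‖B x (e k) (e i)‖).1 h1 i (Finset.mem_univ i)
    simpa using h2
  ext u v
  rw [← e.sum_repr' u, ← e.sum_repr' v]
  simp [hz]

end Harmonic

/-! ### The minimal surface system and its rigidity -/

section MinimalGraph

variable {n m : ℕ} {f : EuclideanSpace ℝ (Fin n) → EuclideanSpace ℝ (Fin m)}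

theorem hasFDerivAt_graphMap {x : EuclideanSpace ℝ (Fin n)} (hf : DifferentiableAt ℝ f x) :
    HasFDerivAt (graphMap f) (inlL n m + inrL n m ∘L fderiv ℝ f x) x := by
  rw [graphMap_eq]
  exact (inlL n m).hasFDerivAt.add ((inrL n m).hasFDerivAt.comp x hf.hasFDerivAt)

theorem tangentPlane_eq {x : EuclideanSpace ℝ (Fin n)} (hf : DifferentiableAt ℝ f x) :
    tangentPlane f x = linearGraph (fderiv ℝ f x) := by
  rw [tangentPlane, (hasFDerivAt_graphMap hf).fderiv, linearGraph]

theorem secondFundamentalForm_eq {x : EuclideanSpace ℝ (Fin n)} (hf : ContDiffAt ℝ 2 f x)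
    (X Y : tangentPlane f x) : secondFundamentalForm f x X Y = (normalPlane f x).starProjection
      (inrL n m (fderiv ℝ (fderiv ℝ f) x (baseProj n m X) (baseProj n m Y))) := by
  have hd : ∀ᶠ y in 𝓝 x, DifferentiableAt ℝ f y :=
    (hf.eventually (by simp)).mono fun y hy => hy.differentiableAt (by simp)
  have h1 : DifferentiableAt ℝ (fderiv ℝ f) x :=
    (hf.fderiv_right (m := 1) (by norm_num)).differentiableAt (by simp)
  have heq : (fun y => fderiv ℝ (graphMap f) y (baseProj n m Y)) =ᶠ[𝓝 x]
      fun y => inlL n m (baseProj n m Y) + inrL n m (fderiv ℝ f y (baseProj n m Y)) :=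
    hd.mono fun y hy => by simp only [(hasFDerivAt_graphMap hy).fderiv]; rfl
  have h2 : HasFDerivAt
      (fun y => inlL n m (baseProj n m Y) + inrL n m (fderiv ℝ f y (baseProj n m Y)))
      ((inrL n m).comp ((ContinuousLinearMap.apply ℝ _ (baseProj n m Y)).comp
        (fderiv ℝ (fderiv ℝ f) x))) x :=
    (((inrL n m).hasFDerivAt.comp x ((ContinuousLinearMap.apply ℝ _
      (baseProj n m Y)).hasFDerivAt.comp x h1.hasFDerivAt) :)).const_add _
  rw [secondFundamentalForm, heq.fderiv_eq, h2.fderiv]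
  rfl

/-- An eigenbasis of `A† ∘ A` lifts to an orthonormal basis of the graph of `A`. -/
theorem exists_orthonormalBasis_linearGraph
    {A : EuclideanSpace ℝ (Fin n) →L[ℝ] EuclideanSpace ℝ (Fin m)} {ι : Type*} [Fintype ι]
    (e : OrthonormalBasis ι ℝ (EuclideanSpace ℝ (Fin n))) {c : ι → ℝ} (hc : ∀ i, 0 ≤ c i)
    (he : ∀ i w, inner ℝ (A (e i)) (A w) = c i * inner ℝ (e i) w) :
    ∃ e' : OrthonormalBasis ι ℝ (linearGraph A),
      ∀ i, baseProj n m (e' i) = (√(1 + c i))⁻¹ • e i := by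
  classical
  have hpos : ∀ i, 0 < √(1 + c i) := fun i => Real.sqrt_pos.2 (by linarith [hc i])
  let v : ι → linearGraph A := fun i =>
    (√(1 + c i))⁻¹ • ⟨_, mem_linearGraph.2 ⟨e i, rfl⟩⟩
  have hv : Orthonormal ℝ v := by
    rw [orthonormal_iff_ite]
    intro i j
    have h := inner_inlL_add_inrL (e i) (e j) (A (e i)) (A (e j))
    rw [he, orthonormal_iff_ite.1 e.orthonormal] at h
    simp only [v, Submodule.coe_inner, Submodule.coe_smul, real_inner_smul_left,
      real_inner_smul_right]
    rw [h]
    split_ifs with hij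
    · subst hij
      have := Real.mul_self_sqrt (by linarith [hc i] : 0 ≤ 1 + c i)
      have := (hpos i).ne'
      field_simp
      linarith
    · simp
  have hcard : Fintype.card ι = Module.finrank ℝ (linearGraph A) := by
    rw [linearGraph, LinearMap.finrank_range_of_inj, Module.finrank_eq_card_basis e.toBasis]
    exact fun a b hab => (inlL_add_inrL_inj.1 hab).1
  refine ⟨OrthonormalBasis.mk hv
    (hv.linearIndependent.span_eq_top_of_card_eq_finrank' hcard).ge, fun i => ?_⟩
  rw [OrthonormalBasis.coe_mk]
  simp only [v, Submodule.coe_smul, map_smul, baseProj_inlL_add_inrL]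

/-- The minimal surface system in an eigenbasis of `A† ∘ A`, `A = Df`. -/
theorem weighted_sum_eq_zero_of_meanCurvature_eq_zero {x : EuclideanSpace ℝ (Fin n)}
    (hf : ContDiffAt ℝ 2 f x) (hmin : meanCurvature f x = 0) {ι : Type*} [Fintype ι]
    (e : OrthonormalBasis ι ℝ (EuclideanSpace ℝ (Fin n))) {c : ι → ℝ} (hc : ∀ i, 0 ≤ c i)
    (he : ∀ i w, inner ℝ (fderiv ℝ f x (e i)) (fderiv ℝ f x w) = c i * inner ℝ (e i) w) :
    ∑ i, (1 + c i)⁻¹ • fderiv ℝ (fderiv ℝ f) x (e i) (e i) = 0 := by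
  have hT := tangentPlane_eq (hf.differentiableAt (by simp))
  obtain ⟨e', he'⟩ : ∃ e' : OrthonormalBasis ι ℝ (tangentPlane f x),
      ∀ i, baseProj n m (e' i) = (√(1 + c i))⁻¹ • e i := by
    rw [hT]
    exact exists_orthonormalBasis_linearGraph e hc he
  set B := fderiv ℝ (fderiv ℝ f) x with hB
  let π : tangentPlane f x →ₗ[ℝ] EuclideanSpace ℝ (Fin n) :=
    baseProj n m ∘ₗ (tangentPlane f x).subtype
  let β : tangentPlane f x →ₗ[ℝ] tangentPlane f x →ₗ[ℝ] EuclideanSpace ℝ (Fin m) :=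
    LinearMap.compl₁₂ (ContinuousLinearMap.coeLM ℝ ∘ₗ (B : _ →ₗ[ℝ] _)) π π
  have hβ : ∀ X, β X X = B (baseProj n m X) (baseProj n m X) := fun X => rfl
  have hsum : ∑ i, β (e' i) (e' i) =
      ∑ i, (1 + c i)⁻¹ • B (e i) (e i) := Finset.sum_congr rfl fun i _ => by
    rw [hβ, he', map_smul, map_smul, smul_apply, smul_smul, ← mul_inv,
      Real.mul_self_sqrt (by linarith [hc i])]
  rw [← hsum, sum_orthonormalBasis_eq e' (stdOrthonormalBasis ℝ (tangentPlane f x)) β]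
  set y := ∑ i, β (stdOrthonormalBasis ℝ (tangentPlane f x) i)
    (stdOrthonormalBasis ℝ (tangentPlane f x) i) with hy
  have hproj : (normalPlane f x).starProjection (inrL n m y) = 0 := by
    rw [← hmin, meanCurvature, hy, map_sum, map_sum]
    exact Finset.sum_congr rfl fun i _ => by rw [secondFundamentalForm_eq hf, hβ]
  -- A vector `(0, y)` tangent to a graph vanishes.
  have hmem : inrL n m y ∈ tangentPlane f x := by
    rw [normalPlane, Submodule.starProjection_orthogonal', sub_apply, one_apply_eq_self,
      sub_eq_zero] at hproj
    rw [hproj]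
    exact Submodule.starProjection_apply_mem _ _
  rw [hT, mem_linearGraph] at hmem
  obtain ⟨v, hv⟩ := hmem
  have h := inlL_add_inrL_inj.1
    (hv.trans (by simp : inrL n m y = inlL n m 0 + inrL n m y))
  rw [← h.2, h.1, map_zero]

/-- A minimal graph over `D` is affine if all eigenvalues of `A† ∘ A` and `A ∘ A†`, `A = Df`, lie in
a fixed set `{a, b}`: the map is harmonic, and the norm of its differential is constant. -/
theorem fderiv_fderiv_eq_zero_of_isMinimalGraph {D : Set (EuclideanSpace ℝ (Fin n))}
    (hD : IsOpen D) (hf : ContDiffOn ℝ ∞ f D) (hmin : IsMinimalGraph f D) {a b : ℝ} (ha : 0 < a)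
    (hb : 0 ≤ b) (hab : a ≠ b)
    (hG : ∀ x ∈ D, ∀ c, IsGramEigenvalue (fderiv ℝ f x) c → c = a ∨ c = b)
    (hH : ∀ x ∈ D, ∀ c, IsGramEigenvalue (adjoint (fderiv ℝ f x)) c → c = a ∨ c = b) :
    ∀ x ∈ D, fderiv ℝ (fderiv ℝ f) x = 0 := by
  have hcurve : ∀ x ∈ D, ∀ v, HasDerivAt (fun t : ℝ => fderiv ℝ f (x + t • v))
      (fderiv ℝ (fderiv ℝ f) x v) 0 ∧ ∀ᶠ t in 𝓝 (0 : ℝ), x + t • v ∈ D := by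
    intro x hx v
    have hl : HasDerivAt (fun t : ℝ => x + t • v) v 0 := by
      simpa using ((hasDerivAt_id (0 : ℝ)).smul_const v).const_add x
    have h0 : x + (0 : ℝ) • v = x := by simp
    have d1 : HasFDerivAt (fderiv ℝ f) (fderiv ℝ (fderiv ℝ f) x) (x + (0 : ℝ) • v) := by
      rw [h0]
      exact (((hf.fderiv_of_isOpen hD (m := ∞) (by simp)).contDiffAt
        (hD.mem_nhds hx)).differentiableAt (by simp)).hasFDerivAt
    exact ⟨d1.comp_hasDerivAt (0 : ℝ) hl, hl.continuousAt.eventually_mem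
      (by rw [h0]; exact hD.mem_nhds hx)⟩
  -- The first-order identities in an eigenbasis, at each point.
  have hpt : ∀ x ∈ D, ∃ (e : OrthonormalBasis (Fin (Module.finrank ℝ (EuclideanSpace ℝ (Fin n)))) ℝ
      (EuclideanSpace ℝ (Fin n))),
      ∑ i, fderiv ℝ (fderiv ℝ f) x (e i) (e i) = 0 ∧ ∀ v,
        ∑ i, inner ℝ (fderiv ℝ (fderiv ℝ f) x v (e i)) (fderiv ℝ f x (e i)) = 0 := by
    intro x hx
    have htwo : minSmoothness ℝ 2 ≤ (∞ : WithTop ℕ∞) := by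
      rw [minSmoothness_of_isRCLikeNormedField]
      exact WithTop.coe_le_coe.2 le_top
    have hfx : ContDiffAt ℝ ∞ f x := hf.contDiffAt (hD.mem_nhds hx)
    obtain ⟨e, c, hcev, he⟩ := exists_orthonormalBasis_gram (fderiv ℝ f x)
    have hc : ∀ i, c i = a ∨ c i = b := fun i => hG x hx _ (hcev i)
    have hfst : ∀ v i j, c i = c j →
        inner ℝ (fderiv ℝ (fderiv ℝ f) x v (e i)) (fderiv ℝ f x (e j)) +
          inner ℝ (fderiv ℝ f x (e i)) (fderiv ℝ (fderiv ℝ f) x v (e j)) = 0 := by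
      intro v i j hij
      obtain ⟨h1, h2⟩ := hcurve x hx v
      have := inner_deriv_add_eq_zero h1 hab (h2.mono fun t ht => hG _ ht) e c hc
        (by simpa using he) hij
      simpa using this
    refine ⟨e, ?_, fun v => Finset.sum_eq_zero fun i _ => ?_⟩
    · refine sum_eq_zero_of_weighted_sum_eq_zero (A := fderiv ℝ f x)
        (hfx.isSymmSndFDerivAt htwo) e ha hb hc he hfst
        (fun v i hi => ?_) (weighted_sum_eq_zero_of_meanCurvature_eq_zero
          (hfx.of_le (WithTop.coe_le_coe.2 le_top)) (hmin x hx) e (fun i => (hcev i).nonneg) he)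
      rcases eq_or_ne b 0 with rfl | hb0
      · have hker : fderiv ℝ f x (e i) = 0 :=
          inner_self_eq_zero (𝕜 := ℝ).1 (by rw [he, hi, zero_mul])
        obtain ⟨h1, h2⟩ := hcurve x hx v
        have := deriv_mem_range h1 ha.ne' (h2.mono fun t ht => hG _ ht) (u := e i)
          (by simpa using hker)
        simpa using this
      · exact surjective_of_gramEigenvalues ha.ne' hb0 (hH x hx) _
    · have h := hfst v i i rfl
      rw [real_inner_comm (fderiv ℝ (fderiv ℝ f) x v (e i)) (fderiv ℝ f x (e i))] at h
      linarith
  let e₀ := stdOrthonormalBasis ℝ (EuclideanSpace ℝ (Fin n))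
  refine fderiv_fderiv_eq_zero_of_harmonic hD hf e₀ (fun x hx => ?_) fun x hx v => ?_
  · obtain ⟨e, h, -⟩ := hpt x hx
    rw [← h]
    exact sum_orthonormalBasis_eq e₀ e
      (ContinuousLinearMap.coeLM ℝ ∘ₗ (fderiv ℝ (fderiv ℝ f) x).toLinearMap)
  · obtain ⟨e, -, h⟩ := hpt x hx
    rw [← h v]
    exact sum_orthonormalBasis_eq e₀ e ((innerₗ (EuclideanSpace ℝ (Fin m))).compl₁₂
      (fderiv ℝ (fderiv ℝ f) x v : _ →ₗ[ℝ] _) (fderiv ℝ f x : _ →ₗ[ℝ] _))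

end MinimalGraph

end JordanAngles

theorem theorem1p1 (n m : ℕ) (D : Set (EuclideanSpace ℝ (Fin n)))
    (hD : IsOpen D) (hDconn : IsConnected D)
    (f : EuclideanSpace ℝ (Fin n) → EuclideanSpace ℝ (Fin m))
    (hf : ContDiffOn ℝ ∞ f D)
    (hmin : JordanAngles.IsMinimalGraph f D)
    (hcja : JordanAngles.HasConstantJordanAngles f D (JordanAngles.coordPlane n m))
    (hgN : ∀ x ∈ D,
      (JordanAngles.normalJordanAngles f (JordanAngles.coordPlane n m) x).encard ≤ 2)
    (hgT : ∀ x ∈ D,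
      (JordanAngles.tangentJordanAngles f (JordanAngles.coordPlane n m) x).encard ≤ 2) :
    (∃ A : EuclideanSpace ℝ (Fin n) →ᵃ[ℝ] EuclideanSpace ℝ (Fin m), ∀ x ∈ D, f x = A x) ∧
    ∃ S : AffineSubspace ℝ (JordanAngles.Ambient n m), Module.finrank ℝ S.direction = n ∧
      JordanAngles.graphMap f '' D = {p | p ∈ S ∧ JordanAngles.baseProj n m p ∈ D} := by
  have hdiff : ∀ x ∈ D, DifferentiableAt ℝ f x := fun x hx =>
    (hf.contDiffAt (hD.mem_nhds hx)).differentiableAt (by simp)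
  have hT : ∀ x ∈ D, JordanAngles.tangentPlane f x = JordanAngles.linearGraph (fderiv ℝ f x) :=
    fun x hx => JordanAngles.tangentPlane_eq (hdiff x hx)
  obtain ⟨a, b, ha, hb, hab, hev⟩ := JordanAngles.exists_gramEigenvalues hDconn.nonempty
    (fderiv ℝ f)
    (fun x hx y hy => by rw [← hT x hx, ← hT y hy]; exact (hcja x hx y hy).1)
    (fun x hx => by rw [← hT x hx]; exact hgN x hx)
    (fun x hx => by rw [← hT x hx]; exact hgT x hx)
  have hB := JordanAngles.fderiv_fderiv_eq_zero_of_isMinimalGraph hD hf hmin ha hb hab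
    (fun x hx => (hev x hx).1) fun x hx => (hev x hx).2
  obtain ⟨L, hL⟩ := hD.exists_is_const_of_fderiv_eq_zero hDconn.isPreconnected
    ((hf.fderiv_of_isOpen hD (m := ∞) (by simp)).differentiableOn (by simp)) hB
  obtain ⟨y, hy⟩ := hD.exists_is_const_of_fderiv_eq_zero (f := fun x => f x - L x)
    hDconn.isPreconnected
    (fun x hx => ((hdiff x hx).sub L.differentiableAt).differentiableWithinAt)
    (fun x hx => by
      rw [((hdiff x hx).hasFDerivAt.fun_sub L.hasFDerivAt).fderiv, hL x hx, sub_self,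
        Pi.zero_apply])
  have hfL : ∀ x ∈ D, f x = L x + y := fun x hx => by rw [← hy x hx]; abel
  refine ⟨⟨L.toLinearMap.toAffineMap + AffineMap.const ℝ _ y, fun x hx => hfL x hx⟩,
    AffineSubspace.mk' (JordanAngles.inrL n m y) (JordanAngles.linearGraph L), ?_, ?_⟩
  · rw [AffineSubspace.direction_mk', JordanAngles.linearGraph, LinearMap.finrank_range_of_inj,
      finrank_euclideanSpace_fin]
    exact fun v w hvw => (JordanAngles.inlL_add_inrL_inj.1 hvw).1
  · ext p
    simp only [Set.mem_image, Set.mem_ofPred_eq, AffineSubspace.mem_mk', vsub_eq_sub,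
      JordanAngles.mem_linearGraph, JordanAngles.graphMap_eq]
    constructor
    · rintro ⟨x, hx, rfl⟩
      refine ⟨⟨x, ?_⟩, by rwa [JordanAngles.baseProj_inlL_add_inrL]⟩
      rw [hfL x hx, map_add]
      abel
    · rintro ⟨⟨x, hx⟩, hp⟩
      have hpx : p = JordanAngles.inlL n m x + JordanAngles.inrL n m (L x + y) := by
        rw [map_add, ← add_assoc, hx, sub_add_cancel]
      rw [hpx, JordanAngles.baseProj_inlL_add_inrL] at hp
      exact ⟨x, hp, by rw [hpx, hfL x hp]⟩
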